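/- **Setting (partial-label regression).** Let $\mathcal X$ be a measurable feature space, $\mathcal Y\subseteq\mathbb R$ a measurable label space, and let $(x,y,S)$ be a random triple consisting of an instance $x\in\mathcal X$, its true label $y\in\mathbb R$ and a finite set $S\subseteq\mathcal Y$ of candidate labels, with $y\in S$ almost surely. Let $\ell:\mathbb R\times\mathbb R\to\mathbb R$ be a measurable loss, $\mathcal F$ a class of measurable functions $f:\mathcal X\to\mathbb R$, and $w$ a measurable weighting function such that, for almost every training example $(x,S)$, the weights $w(x,y')$ of the candidate labels $y'\in S$ (which may also depend on $S$) satisfy $w(x,y')\ge 0$ for $y'\in S$ and $\sum_{y'\in S}w(x,y')=1$. Put $$\ell_{\rm wet}(f(x),S)=\sum_{y'\in S}w(x,y')\,\ell(f(x),y'),\quad R(f)=\mathbb E[\ell(f(x),y)],\quad R_{\rm wet}(f)=\mathbb E[\ell_{\rm wet}(f(x),S)],$$ and, for training examples $(x_1,S_1),\dots,(x_n,S_n)$ drawn independently from the law of $(x,S)$, $\widehat R_{\rm wet}(f)=\frac1n\sum_{i=1}^n\ell_{\rm wet}(f(x_i),S_i)$. Assume that the class of functions $(x,S)\mapsto\ell_{\rm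 wet}(f(x),S)$, $f\in\mathcal F$, is measurable in the usual sense of empirical process theory: for all $n$ and $e\in\mathbb R^n$, $\sup_{f\in\mathcal F}|\sum_i e_i\,\ell_{\rm wet}(f(x_i),S_i)|$ is measurable for the completed law of the sample. **Theorem.** Let $d\in\mathbb N$, $M\in\mathbb R$ and $\delta>0$. There is a constant $C$ depending only on $d$, $M$ and $\delta$ with the following property. Suppose, in the setting above, that the pseudo-dimension of the class $\{(x,y)\mapsto\ell(f(x),y)\mid f\in\mathcal F\}$ of functions on $\mathcal X\times\mathcal Y$ is at most $d$, and that $|\ell(f(x),y)|\le M$ for all $(x,y)\in\mathcal X\times\mathcal Y$ and $f\in\mathcal F$. Let $f^\star$ be a minimizer of $R$ over $\mathcal F$. Then for every $n\ge1$, with probability at least $1-\delta$, every minimizer $\widehat f_{\rm wet}$ of $\widehat R_{\rm wet}$ over $\mathcal F$ satisfies $$R_{\rm wet}(\widehat f_{\rm wet})-R_{\rm wet}(f^\star)\le\frac{C}{\sqrt n}.$$ If moreover the weights are optimal, i.e. almost surely $w(x,y)=1$ for the true label $y$ and $w(x,y')=0$ for the other $y'\in S$, then for every $n\ge1$, with probability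 at least $1-\delta$, every such $\widehat f_{\rm wet}$ satisfies $|R_{\rm wet}(\widehat f_{\rm wet})-R_{\rm wet}(f^\star)|\le C/\sqrt n$. (Probabilities of possibly non-measurable exceptional events are outer probabilities.) -/

import Mathlib

open MeasureTheory

namespace PLR

/-! ### Pseudo-dimension -/

/-- The finite set `A` is (pseudo-)shattered by the class `G` of real functions: for suitable
thresholds `t z`, `z ∈ A`, every pattern `T ⊆ A` is realised as `{z ∈ A | t z < g z}`, `g ∈ G`. -/
def PseudoShatters {Z : Type*} (G : Set (Z → ℝ)) (A : Finset Z) : Prop :=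
  ∃ t : Z → ℝ, ∀ T : Finset Z, T ⊆ A → ∃ g ∈ G, ∀ z ∈ A, (t z < g z ↔ z ∈ T)

/-- The pseudo-dimension of `G`: the supremum of the sizes of the finite sets it shatters. -/
noncomputable def pseudoDim {Z : Type*} (G : Set (Z → ℝ)) : ℕ∞ :=
  ⨆ (A : Finset Z) (_ : PseudoShatters G A), (A.card : ℕ∞)

/-! ### Measurability of a class of functions -/

/-- The class `G` is `P`-measurable (in the usual sense of empirical process theory): for all
`n` and all real `e₁, …, eₙ`, the function `(z₁, …, zₙ) ↦ sup_{g ∈ G} |∑ eᵢ g(zᵢ)|` is measurable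
for the completion of the product measure `Pⁿ`. -/
def IsMeasurableClass {Z : Type*} [MeasurableSpace Z] (P : Measure Z) (G : Set (Z → ℝ)) : Prop :=
  ∀ (n : ℕ) (e : Fin n → ℝ),
    AEMeasurable (fun s : Fin n → Z => ⨆ g : G, |∑ i, e i * (g : Z → ℝ) (s i)|)
      (Measure.pi fun _ => P)

/-! ### Partial-label regression -/

/-- A set of real-valued candidate labels: a finite set of reals. -/
structure CandidateSet where
  /-- The candidate labels. -/
  labels : Finset ℝ

/-- The usual σ-algebra on finite point sets: it is generated by the maps `S ↦ #(S ∩ B)`, where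
`B` is a Borel set. (Mathlib's σ-algebra on `Finset ℝ` is generated by the events `a ∈ S` alone;
it is too small for sums over `S` to be measurable.) -/
noncomputable instance CandidateSet.instMeasurableSpace : MeasurableSpace CandidateSet :=
  ⨆ B : {B : Set ℝ // MeasurableSet B},
    MeasurableSpace.comap (fun S : CandidateSet => ((S.labels : Set ℝ) ∩ B.1).ncard) ⊤

/-- `f` minimises the functional `R` over the class `F`. -/
def IsMinimizer {α : Type*} (F : Set α) (R : α → ℝ) (f : α) : Prop :=
  f ∈ F ∧ ∀ g ∈ F, R f ≤ R g

/-- The law of a training example `(x, S)`, where `(x, y, S)` has law `ρ` (`y` the true label). -/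
noncomputable def trainLaw {X : Type*} [MeasurableSpace X]
    (ρ : Measure (X × ℝ × CandidateSet)) : Measure (X × CandidateSet) :=
  ρ.map fun z => (z.1, z.2.2)

/-- The risk `R(f) = 𝔼[ℓ(f(x), y)]` with respect to the true label. -/
noncomputable def risk {X : Type*} [MeasurableSpace X] (ℓ : ℝ → ℝ → ℝ)
    (ρ : Measure (X × ℝ × CandidateSet)) (f : X → ℝ) : ℝ :=
  ∫ z, ℓ (f z.1) z.2.1 ∂ρ

/-- The weighted loss `ℓ_wet(f(x), S) = ∑_{y ∈ S} w(x, y) ℓ(f(x), y)`. The weights of the candidate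
labels of a training example `(x, S)` may also depend on `S`. -/
noncomputable def wetLoss {X : Type*} (ℓ : ℝ → ℝ → ℝ) (w : X → CandidateSet → ℝ → ℝ)
    (f : X → ℝ) (z : X × CandidateSet) : ℝ :=
  ∑ y ∈ z.2.labels, w z.1 z.2 y * ℓ (f z.1) y

/-- The expected risk `R_wet(f) = 𝔼[ℓ_wet(f(x), S)]`. -/
noncomputable def wetRisk {X : Type*} [MeasurableSpace X] (ℓ : ℝ → ℝ → ℝ)
    (w : X → CandidateSet → ℝ → ℝ) (P : Measure (X × CandidateSet)) (f : X → ℝ) : ℝ :=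
  ∫ z, wetLoss ℓ w f z ∂P

/-- The empirical risk `R̂_wet(f) = (1/n) ∑ᵢ ℓ_wet(f(xᵢ), Sᵢ)` on the sample `s`. -/
noncomputable def empWetRisk {X : Type*} (ℓ : ℝ → ℝ → ℝ) (w : X → CandidateSet → ℝ → ℝ)
    {n : ℕ} (s : Fin n → X × CandidateSet) (f : X → ℝ) : ℝ :=
  (1 / (n : ℝ)) * ∑ i, wetLoss ℓ w f (s i)

/-- The loss class `{(x, y) ↦ ℓ(f(x), y) | f ∈ F}` on `X × 𝒴`. -/
def lossClass {X : Type*} (ℓ : ℝ → ℝ → ℝ) (𝒴 : Set ℝ) (F : Set (X → ℝ)) : Set (X × 𝒴 → ℝ) :=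
  {g | ∃ f ∈ F, g = fun p => ℓ (f p.1) p.2}

end PLR

/-! An empirical minimizer loses at most twice the uniform deviation of empirical from expected
weighted losses. It therefore suffices to dominate that deviation by a function of mean `O(1/√n)`;
Markov's inequality then gives a constant proportional to `1/δ`.

Symmetrization (`exists_deviation_majorant`) reduces this to Rademacher averages at a fixed sample.
There the weights disappear (`expect_abs_sign_weighted_le`): a weighted loss is the mean of `ℓ (f x)
y` over a random label drawn with the weights. By convexity the Rademacher average is at most a
mean, over independent choices of one label per example, of Rademacher averages of the original loss
class. No dimension of the weighted class is needed.

For the loss class (`expect_abs_sign_le_of_pseudoDim`), a layer-cake integral replaces functions by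
superlevel sets. Sauer–Shelah shows that these leave polynomially many traces, random sampling turns
this into packing numbers whose logarithm at Hamming radius `n / 4 ^ k` is linear in `k`, and
chaining (`expect_abs_sign_ind_le`) sums the scales to `O(√n)` without a logarithmic factor.

Suprema over a class inside a sign average are expressed by arbitrary selectors `ε ↦ γ ε`. A
selector passes through the layer-cake integral and the choice of labels unchanged. -/

open scoped BigOperators symmDiff

namespace PLR

/-! ### Rademacher averages of finite families -/

/-- The Rademacher sign attached to a Boolean. -/
def sgn (b : Bool) : ℝ := if b then 1 else -1

/-- The exponential factorizes over coordinates, and each factor is controlled by `cosh x ≤ exp (x²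
/ 2)`. -/
theorem sum_exp_sign_le {ι : Type*} [Fintype ι] [DecidableEq ι] (v : ι → ℝ) (σ2 lam : ℝ)
    (hv : ∑ i, v i ^ 2 ≤ σ2) :
    ∑ ε : ι → Bool, Real.exp (lam * ∑ i, sgn (ε i) * v i)
      ≤ 2 ^ Fintype.card ι * Real.exp (lam ^ 2 * σ2 / 2) := by
  have h1 : ∑ ε : ι → Bool, Real.exp (lam * ∑ i, sgn (ε i) * v i)
      = ∏ i, ∑ b : Bool, Real.exp (lam * (sgn b * v i)) := by
    rw [Finset.prod_univ_sum, Fintype.piFinset_univ]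
    refine Finset.sum_congr rfl fun ε _ => ?_
    rw [Finset.mul_sum, Real.exp_sum]
  have h2 : ∀ i, ∑ b : Bool, Real.exp (lam * (sgn b * v i))
      ≤ 2 * Real.exp (lam ^ 2 * v i ^ 2 / 2) := by
    intro i
    have := Real.cosh_le_exp_half_sq (lam * v i)
    rw [Real.cosh_eq] at this
    rw [mul_pow] at this
    simp only [Fintype.sum_bool, sgn]
    norm_num
    linarith
  rw [h1]
  calc ∏ i, ∑ b : Bool, Real.exp (lam * (sgn b * v i))
      ≤ ∏ i, (2 * Real.exp (lam ^ 2 * v i ^ 2 / 2)) :=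
        Finset.prod_le_prod (fun i _ => Finset.sum_nonneg fun _ _ => (Real.exp_pos _).le)
          fun i _ => h2 i
    _ = 2 ^ Fintype.card ι * Real.exp (lam ^ 2 * (∑ i, v i ^ 2) / 2) := by
        rw [Finset.prod_mul_distrib, ← Real.exp_sum, Finset.prod_const, Finset.card_univ,
          Finset.mul_sum, Finset.sum_div]
    _ ≤ _ := by gcongr

/-- Massart's finite maximal inequality. The parameter `lam` stays free, so that chaining can pick a
convenient value at each scale. -/
theorem expect_abs_sign_sum_le {ι κ : Type*} [Fintype ι] [DecidableEq ι] (T : Finset κ)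
    (v : κ → ι → ℝ) {σ2 L lam : ℝ} (hv : ∀ k ∈ T, ∑ i, v k i ^ 2 ≤ σ2)
    (hL : Real.log (2 * T.card) ≤ L) (hlam : 0 < lam) (τ : (ι → Bool) → κ)
    (hτ : ∀ ε, τ ε ∈ T) :
    𝔼 ε, |∑ i, sgn (ε i) * v (τ ε) i| ≤ L / lam + lam * σ2 / 2 := by
  have hT : 0 < (T.card : ℝ) := by
    exact_mod_cast Finset.card_pos.2 ⟨_, hτ fun _ => true⟩
  set N : ℝ := 2 * T.card * Real.exp (lam ^ 2 * σ2 / 2) with hN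
  have hNpos : 0 < N := by positivity
  have hlogN : Real.log N = Real.log (2 * T.card) + lam ^ 2 * σ2 / 2 := by
    rw [hN, Real.log_mul (by positivity) (Real.exp_pos _).ne', Real.log_exp]
  -- The tangent to `exp` at `log N` lies below it; this linear bound takes the place of Jensen's
  -- inequality for the logarithm.
  have hpt : ∀ ε : ι → Bool, lam * |∑ i, sgn (ε i) * v (τ ε) i|
      ≤ (Real.log N - 1) + Real.exp (lam * |∑ i, sgn (ε i) * v (τ ε) i|) / N := by
    intro ε
    have := Real.add_one_le_exp (lam * |∑ i, sgn (ε i) * v (τ ε) i| - Real.log N)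
    rw [Real.exp_sub, Real.exp_log hNpos] at this
    linarith
  have hsum : ∑ ε : ι → Bool, Real.exp (lam * |∑ i, sgn (ε i) * v (τ ε) i|)
      ≤ 2 ^ Fintype.card ι * N := by
    calc ∑ ε : ι → Bool, Real.exp (lam * |∑ i, sgn (ε i) * v (τ ε) i|)
        ≤ ∑ ε : ι → Bool, ∑ k ∈ T, (Real.exp (lam * ∑ i, sgn (ε i) * v k i)
            + Real.exp ((-lam) * ∑ i, sgn (ε i) * v k i)) := by
          refine Finset.sum_le_sum fun ε _ => ?_
          refine le_trans ?_ (Finset.single_le_sum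
            (f := fun k => Real.exp (lam * ∑ i, sgn (ε i) * v k i)
            + Real.exp ((-lam) * ∑ i, sgn (ε i) * v k i)) (fun k _ => by positivity) (hτ ε))
          have h1 := Real.exp_pos (lam * ∑ i, sgn (ε i) * v (τ ε) i)
          have h2 := Real.exp_pos ((-lam) * ∑ i, sgn (ε i) * v (τ ε) i)
          rcases abs_cases (∑ i, sgn (ε i) * v (τ ε) i) with h | h
          · rw [h.1]; linarith
          · rw [h.1, mul_neg, ← neg_mul]; linarith
      _ = ∑ k ∈ T, (∑ ε : ι → Bool, Real.exp (lam * ∑ i, sgn (ε i) * v k i)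
            + ∑ ε : ι → Bool, Real.exp ((-lam) * ∑ i, sgn (ε i) * v k i)) := by
          rw [Finset.sum_comm]
          exact Finset.sum_congr rfl fun k _ => Finset.sum_add_distrib
      _ ≤ ∑ k ∈ T, 2 * (2 ^ Fintype.card ι * Real.exp (lam ^ 2 * σ2 / 2)) := by
          refine Finset.sum_le_sum fun k hk => ?_
          have h1 := sum_exp_sign_le (v k) σ2 lam (hv k hk)
          have h2 := sum_exp_sign_le (v k) σ2 (-lam) (hv k hk)
          rw [neg_sq] at h2
          linarith
      _ = _ := by rw [Finset.sum_const, nsmul_eq_mul, hN]; ring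
  have hmain : lam * 𝔼 ε, |∑ i, sgn (ε i) * v (τ ε) i| ≤ Real.log N := by
    rw [Finset.mul_expect]
    calc 𝔼 ε, lam * |∑ i, sgn (ε i) * v (τ ε) i|
        ≤ 𝔼 ε : ι → Bool, ((Real.log N - 1)
            + Real.exp (lam * |∑ i, sgn (ε i) * v (τ ε) i|) / N) :=
          Finset.expect_le_expect fun ε _ => hpt ε
      _ = (Real.log N - 1)
          + (∑ ε : ι → Bool, Real.exp (lam * |∑ i, sgn (ε i) * v (τ ε) i|))
            / (2 ^ Fintype.card ι * N) := by
          rw [Finset.expect_add_distrib, Fintype.expect_const, ← Finset.expect_div,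
            Fintype.expect_eq_sum_div_card, div_div]
          simp
      _ ≤ (Real.log N - 1) + 1 := by
          gcongr
          exact div_le_one_of_le₀ hsum (by positivity)
      _ = _ := by ring
  rw [hlogN] at hmain
  have : L / lam + lam * σ2 / 2 = (L + lam ^ 2 * σ2 / 2) / lam := by field_simp
  rw [this, le_div_iff₀ hlam]
  linarith

/-! ### Packing numbers of families with polynomial growth -/

/-- The trace of `A` on the points `s j`. -/
def trace {α : Type*} [DecidableEq α] {m : ℕ} (s : Fin m → α) (A : Finset α) : Finset (Fin m) :=
  Finset.univ.filter fun j => s j ∈ A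

/-- The family `𝒜` leaves at most `(m + 1) ^ d` traces on any `m` points. -/
def HasGrowth {α : Type*} [DecidableEq α] (𝒜 : Finset (Finset α)) (d : ℕ) : Prop :=
  ∀ (m : ℕ) (s : Fin m → α), (𝒜.image (trace s)).card ≤ (m + 1) ^ d

theorem card_forall_notMem {α : Type*} [Fintype α] [DecidableEq α] (D : Finset α) (m : ℕ) :
    (Finset.univ.filter fun s : Fin m → α => ∀ j, s j ∉ D).card
      = (Fintype.card α - D.card) ^ m := by
  have : (Finset.univ.filter fun s : Fin m → α => ∀ j, s j ∉ D)
      = Fintype.piFinset fun _ : Fin m => Dᶜ := by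
    ext s; simp [Fintype.mem_piFinset]
  rw [this, Fintype.card_piFinset]
  simp [Finset.card_compl]

/-- Random points separate the members of a separated family. -/
theorem exists_injOn_trace {n : ℕ} (ℬ : Finset (Finset (Fin n))) (hn : 0 < n) {θ : ℝ}
    (hsep : ∀ A ∈ ℬ, ∀ B ∈ ℬ, A ≠ B → θ * n ≤ (A ∆ B).card) {m : ℕ}
    (hm : (ℬ.card : ℝ) ^ 2 * Real.exp (-(θ * m)) < 1) :
    ∃ s : Fin m → Fin n, Set.InjOn (trace s) (ℬ : Set (Finset (Fin n))) := by
  by_contra! hcon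
  -- If no sample separates, every sample misses some `A ∆ B` entirely. One pair accounts for at
  -- most `n ^ m * exp (-(θ * m))` samples, so the union bound contradicts `hm`.
  have hcover : (Finset.univ : Finset (Fin m → Fin n)) ⊆
      ((ℬ ×ˢ ℬ).filter fun p => p.1 ≠ p.2).biUnion fun p =>
        Finset.univ.filter fun s : Fin m → Fin n => ∀ j, s j ∉ p.1 ∆ p.2 := by
    intro s _
    have := hcon s
    simp only [Set.InjOn, not_forall] at this
    obtain ⟨A, hA, B, hB, hAB, hne⟩ := this
    simp only [Finset.mem_biUnion, Finset.mem_filter, Finset.mem_product, Finset.mem_univ,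
      true_and]
    refine ⟨(A, B), ⟨⟨hA, hB⟩, hne⟩, fun j hj => ?_⟩
    have h1 : j ∈ trace s A ↔ j ∈ trace s B := by rw [hAB]
    simp only [trace, Finset.mem_filter, Finset.mem_univ, true_and] at h1
    rw [Finset.mem_symmDiff] at hj
    tauto
  have hn' : (0 : ℝ) < n := by exact_mod_cast hn
  have hcard : ((n : ℝ)) ^ m ≤ (ℬ.card : ℝ) ^ 2 * ((n : ℝ) ^ m * Real.exp (-(θ * m))) := by
    have h1 := (Finset.card_le_card hcover).trans Finset.card_biUnion_le
    rw [Finset.card_univ, Fintype.card_fun, Fintype.card_fin, Fintype.card_fin] at h1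
    have h2 : ((n : ℝ)) ^ m ≤ ∑ p ∈ (ℬ ×ˢ ℬ).filter fun p => p.1 ≠ p.2,
        ((Finset.univ.filter fun s : Fin m → Fin n => ∀ j, s j ∉ p.1 ∆ p.2).card : ℝ) := by
      exact_mod_cast h1
    refine h2.trans ?_
    calc _ ≤ ∑ p ∈ (ℬ ×ˢ ℬ).filter fun p => p.1 ≠ p.2, ((n : ℝ) ^ m * Real.exp (-(θ * m))) := by
          refine Finset.sum_le_sum fun p hp => ?_
          simp only [Finset.mem_filter, Finset.mem_product] at hp
          have h3 := hsep p.1 hp.1.1 p.2 hp.1.2 hp.2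
          have h4 : (p.1 ∆ p.2).card ≤ n := by simpa using Finset.card_le_univ (p.1 ∆ p.2)
          rw [card_forall_notMem, Fintype.card_fin, Nat.cast_pow, Nat.cast_sub h4]
          have h5 : (n : ℝ) - ((p.1 ∆ p.2).card : ℝ) ≤ n * Real.exp (-θ) := by
            have := Real.add_one_le_exp (-θ)
            nlinarith
          have h6 : (0 : ℝ) ≤ (n : ℝ) - ((p.1 ∆ p.2).card : ℝ) := by
            have : ((p.1 ∆ p.2).card : ℝ) ≤ n := by exact_mod_cast h4
            linarith
          calc _ ≤ (n * Real.exp (-θ)) ^ m := pow_le_pow_left₀ h6 h5 m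
            _ = _ := by rw [mul_pow, ← Real.exp_nat_mul]; congr 2; ring
      _ ≤ _ := by
          rw [Finset.sum_const, nsmul_eq_mul]
          gcongr
          have : ((ℬ ×ˢ ℬ).filter fun p => p.1 ≠ p.2).card ≤ ℬ.card ^ 2 := by
            rw [sq, ← Finset.card_product]; exact Finset.card_filter_le _ _
          exact_mod_cast this
  have : (n : ℝ) ^ m * 1 ≤ (n : ℝ) ^ m * ((ℬ.card : ℝ) ^ 2 * Real.exp (-(θ * m))) := by
    linarith
  have := le_of_mul_le_mul_left this (by positivity)
  linarith

/-- About `2 * L * 4 ^ k` random points keep all members distinct, so growth gives `|ℬ| ≤ (m + 1) ^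
d` with `m` proportional to `L = log |ℬ|`. The resulting inequality bounds `L` by a multiple of `log
L + k` and can be solved for `L`. -/
theorem log_card_le_of_separated {n : ℕ} {𝒜 ℬ : Finset (Finset (Fin n))} {d : ℕ}
    (h𝒜 : HasGrowth 𝒜 d) (hℬ : ℬ ⊆ 𝒜) (hn : 0 < n) (k : ℕ)
    (hsep : ∀ A ∈ ℬ, ∀ B ∈ ℬ, A ≠ B → n ≤ 4 ^ k * (A ∆ B).card) :
    Real.log ℬ.card ≤ 16 * ((d : ℝ) + 1) ^ 2 * (k + 1) := by
  set L := Real.log ℬ.card with hL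
  have hk0 : (0 : ℝ) ≤ k := Nat.cast_nonneg k
  have hd0 : (0 : ℝ) ≤ d := Nat.cast_nonneg d
  rcases lt_or_ge L 1 with h1 | h1
  · nlinarith [mul_nonneg hd0 hk0, mul_nonneg (mul_nonneg hd0 hd0) hk0]
  have hN0 : (0 : ℝ) < ℬ.card := by
    rcases Nat.eq_zero_or_pos ℬ.card with h | h
    · rw [hL, h] at h1; norm_num at h1
    · exact_mod_cast h
  have h4 : (0 : ℝ) < 4 ^ k := by positivity
  have h4' : (1 : ℝ) ≤ 4 ^ k := one_le_pow₀ (by norm_num)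
  set m : ℕ := ⌊2 * L * 4 ^ k⌋₊ + 1 with hm
  have hm1 : 2 * L * 4 ^ k < m := by
    rw [hm]; push_cast; exact Nat.lt_floor_add_one _
  have hm2 : (m : ℝ) ≤ 2 * L * 4 ^ k + 1 := by
    rw [hm]; push_cast
    have := Nat.floor_le (show 0 ≤ 2 * L * 4 ^ k by positivity)
    linarith
  obtain ⟨s, hs⟩ := exists_injOn_trace ℬ hn (θ := (4 ^ k : ℝ)⁻¹) (m := m)
    (by
      intro A hA B hB hAB
      have := hsep A hA B hB hAB
      rw [inv_mul_le_iff₀ h4]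
      exact_mod_cast this)
    (by
      have : (ℬ.card : ℝ) ^ 2 = Real.exp (2 * L) := by
        rw [two_mul, Real.exp_add, hL, Real.exp_log hN0, sq]
      rw [this, ← Real.exp_add, Real.exp_lt_one_iff]
      have : 2 * L < (4 ^ k : ℝ)⁻¹ * m := by
        rw [lt_inv_mul_iff₀ h4]; linarith
      linarith)
  have hcard : (ℬ.card : ℝ) ≤ ((m : ℝ) + 1) ^ (d + 1) := by
    have h2 : ℬ.card ≤ (m + 1) ^ d := by
      rw [← Finset.card_image_of_injOn hs]
      exact (Finset.card_le_card (Finset.image_subset_image hℬ)).trans (h𝒜 m s)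
    have h3 : (m + 1) ^ d ≤ (m + 1) ^ (d + 1) := Nat.pow_le_pow_right (by omega) (by omega)
    exact_mod_cast h2.trans h3
  have hLd : L ≤ (d + 1) * Real.log (4 * L * 4 ^ k) := by
    have h2 : L ≤ Real.log (((m : ℝ) + 1) ^ (d + 1)) := Real.log_le_log hN0 hcard
    rw [Real.log_pow] at h2
    push_cast at h2
    refine h2.trans ?_
    gcongr
    nlinarith
  -- The factor `L / (2 * (d + 1))` is split off so that, after `log x ≤ x` and multiplication by `d
  -- + 1`, it costs only `L / 2`. The exponent `d + 1` allows this division also for `d = 0`.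
  have hlog : Real.log (4 * L * 4 ^ k) ≤ L / (2 * (d + 1)) + 8 * (d + 1) + 2 * k := by
    have hA : (0 : ℝ) < 8 * (d + 1) := by positivity
    have e : 4 * L * 4 ^ k = (L / (2 * (d + 1))) * (8 * (d + 1)) * 4 ^ k := by
      field_simp; ring
    have hlog4 : Real.log 4 ≤ 2 := by
      have := Real.log_two_lt_d9
      rw [show (4 : ℝ) = 2 ^ 2 by norm_num, Real.log_pow]; push_cast; linarith
    rw [e, Real.log_mul (by positivity) (by positivity), Real.log_mul (by positivity) hA.ne',
      Real.log_pow]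
    have h2 := Real.log_le_self (show 0 ≤ L / (2 * (d + 1)) by positivity)
    have h3 := Real.log_le_self hA.le
    nlinarith
  have hLd2 : L ≤ L / 2 + (d + 1) * (8 * (d + 1) + 2 * k) := by
    refine hLd.trans ((mul_le_mul_of_nonneg_left hlog (by positivity)).trans (le_of_eq ?_))
    field_simp
    ring
  nlinarith [mul_nonneg hd0 hk0, mul_nonneg (mul_nonneg hd0 hd0) hk0]

/-! ### Chaining for families of sets -/

/-- The indicator vector of a finite set. -/
def ind {α : Type*} [DecidableEq α] (A : Finset α) (i : α) : ℝ := if i ∈ A then 1 else 0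

theorem sum_sq_ind_sub {α : Type*} [Fintype α] [DecidableEq α] (A B : Finset α) :
    ∑ i, (ind A i - ind B i) ^ 2 = (A ∆ B).card := by
  have : ∀ i, (ind A i - ind B i) ^ 2 = if i ∈ A ∆ B then (1 : ℝ) else 0 := by
    intro i
    by_cases h1 : i ∈ A <;> by_cases h2 : i ∈ B <;> simp [ind, h1, h2, Finset.mem_symmDiff]
  simp [this]

theorem card_symmDiff_le_add {α : Type*} [DecidableEq α] (A B D : Finset α) :
    (A ∆ D).card ≤ (A ∆ B).card + (B ∆ D).card :=
  (Finset.card_le_card (symmDiff_triangle A B D)).trans (Finset.card_union_le _ _)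

/-- A separated subfamily of maximal cardinality is automatically a net. -/
theorem exists_net {n : ℕ} (𝒜 : Finset (Finset (Fin n))) (hn : 0 < n) (k : ℕ) :
    ∃ ℬ ⊆ 𝒜, (∀ A ∈ ℬ, ∀ B ∈ ℬ, A ≠ B → n ≤ 4 ^ k * (A ∆ B).card) ∧
      ∀ A ∈ 𝒜, ∃ B ∈ ℬ, 4 ^ k * (A ∆ B).card < n := by
  classical
  obtain ⟨ℬ, hℬ, hmax⟩ := Finset.exists_max_image
    (𝒜.powerset.filter fun ℬ => ∀ A ∈ ℬ, ∀ B ∈ ℬ, A ≠ B → n ≤ 4 ^ k * (A ∆ B).card)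
    Finset.card ⟨∅, by simp⟩
  simp only [Finset.mem_filter, Finset.mem_powerset] at hℬ hmax
  refine ⟨ℬ, hℬ.1, hℬ.2, fun A hA => ?_⟩
  by_contra! hcon
  have hAℬ : A ∉ ℬ := fun h => by
    have := hcon A h
    simp at this
    omega
  have := hmax (insert A ℬ) ⟨Finset.insert_subset hA hℬ.1, by
    intro B hB D hD hne
    rw [Finset.mem_insert] at hB hD
    rcases hB with rfl | hB <;> rcases hD with rfl | hD
    · exact absurd rfl hne
    · exact hcon D hD
    · rw [symmDiff_comm]; exact hcon B hB
    · exact hℬ.2 B hB D hD hne⟩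
  rw [Finset.card_insert_of_notMem hAℬ] at this
  omega

/-- The constant in the bound on the Rademacher averages of a family with polynomial growth. -/
noncomputable def chainConst (d : ℕ) : ℝ := 32 * ((d : ℝ) + 1) ^ 2 + 4

theorem chainConst_pos (d : ℕ) : 0 < chainConst d := by unfold chainConst; positivity

/-- Chaining along nets of Hamming radius `n / 4 ^ k`: the increment between consecutive nets is a
finite maximum with variance of order `n / 4 ^ k` and log-cardinality of order `k`, and these
contributions are summable. -/
theorem expect_abs_sign_ind_le {n : ℕ} {𝒜 : Finset (Finset (Fin n))} {d : ℕ}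
    (h𝒜 : HasGrowth 𝒜 d) (τ : (Fin n → Bool) → Finset (Fin n)) (hτ : ∀ ε, τ ε ∈ 𝒜) :
    𝔼 ε, |∑ i, sgn (ε i) * ind (τ ε) i| ≤ 4 * chainConst d * √(n : ℝ) := by
  rcases Nat.eq_zero_or_pos n with rfl | hn
  · simp
  have hn' : (0 : ℝ) < n := by exact_mod_cast hn
  have hsq : 0 < √(n : ℝ) := Real.sqrt_pos.2 hn'
  have hsq2 : √(n : ℝ) * √(n : ℝ) = n := Real.mul_self_sqrt hn'.le
  choose N hN𝒜 hNsep hNnet using exists_net 𝒜 hn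
  choose! π hπN hπ using hNnet
  set a : ℝ := 16 * ((d : ℝ) + 1) ^ 2 with ha
  have ha0 : 0 ≤ a := by positivity
  have hc : chainConst d = 2 * a + 4 := by rw [chainConst, ha]; ring
  have hlogN : ∀ k, Real.log (N k).card ≤ a * (k + 1) := fun k =>
    log_card_le_of_separated h𝒜 (hN𝒜 k) hn k (hNsep k)
  have hNpos : ∀ k, (0 : ℝ) < (N k).card := fun k => by
    exact_mod_cast Finset.card_pos.2 ⟨_, hπN k _ (hτ fun _ => true)⟩
  have hlog2 : Real.log 2 ≤ 1 := by have := Real.log_two_lt_d9; linarith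
  -- The right-hand side is the closed form of `1 + ∑ (j + 2) / 2 ^ (j + 1)` over `j < K`.
  have hstep : ∀ K : ℕ, 𝔼 ε, |∑ i, sgn (ε i) * ind (π K (τ ε)) i|
      ≤ chainConst d * √(n : ℝ) * (4 - (K + 3) / 2 ^ K) := by
    intro K
    induction K with
    | zero =>
      refine (expect_abs_sign_sum_le (N 0) ind (σ2 := n) (L := 1 + a) (lam := 1 / √(n : ℝ))
        ?_ ?_ (by positivity) (fun ε => π 0 (τ ε)) fun ε => hπN 0 _ (hτ ε)).trans ?_
      · intro A _
        have h := sum_sq_ind_sub A ∅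
        simp only [ind, Finset.notMem_empty, if_false, sub_zero] at h ⊢
        rw [h]
        exact_mod_cast (Finset.card_le_univ _).trans_eq (Fintype.card_fin n)
      · rw [Real.log_mul two_ne_zero (hNpos 0).ne']
        have := hlogN 0
        norm_num at this
        linarith
      · have : 1 / √(n : ℝ) * n / 2 = √(n : ℝ) / 2 := by
          nth_rewrite 2 [← hsq2]; field_simp
        rw [this, hc]
        norm_num
        nlinarith
    | succ K ih =>
      have h4 : (0 : ℝ) < 4 ^ (K + 1) := by positivity
      have h2 : (0 : ℝ) < 2 ^ (K + 1) := by positivity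
      have h42 : (4 : ℝ) ^ (K + 1) = 2 ^ (K + 1) * 2 ^ (K + 1) := by
        rw [← mul_pow]; norm_num
      have hinc : 𝔼 ε, |∑ i, sgn (ε i) * (ind (π (K + 1) (τ ε)) i - ind (π K (τ ε)) i)|
          ≤ chainConst d * √(n : ℝ) * ((K + 2) / 2 ^ (K + 1)) := by
        -- Only pairs of nearby centres occur: both approximate the same set, at distances below `n
        -- / 4 ^ (K + 1)` and `4 * n / 4 ^ (K + 1)`, whence the 5. Taking `lam` proportional to `2 ^
        -- (K + 1)` balances the variance term against `1 / lam`.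
        refine (expect_abs_sign_sum_le
          ((N (K + 1) ×ˢ N K).filter fun p => 4 ^ (K + 1) * (p.1 ∆ p.2).card ≤ 5 * n)
          (fun p i => ind p.1 i - ind p.2 i) (σ2 := 5 * n / 4 ^ (K + 1))
          (L := 1 + 2 * a * (K + 2)) (lam := 2 ^ (K + 1) / √(n : ℝ))
          ?_ ?_ (by positivity) (fun ε => (π (K + 1) (τ ε), π K (τ ε))) ?_).trans ?_
        · intro p hp
          rw [sum_sq_ind_sub, le_div_iff₀ h4, mul_comm]
          exact_mod_cast (Finset.mem_filter.1 hp).2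
        · have hle : (((N (K + 1) ×ˢ N K).filter fun p =>
              4 ^ (K + 1) * (p.1 ∆ p.2).card ≤ 5 * n).card : ℝ)
              ≤ (N (K + 1)).card * (N K).card := by
            rw [← Nat.cast_mul, ← Finset.card_product]
            exact_mod_cast Finset.card_filter_le _ _
          -- The convention `Real.log 0 = 0` settles an empty set of pairs.
          rcases Nat.eq_zero_or_pos ((N (K + 1) ×ˢ N K).filter fun p =>
              4 ^ (K + 1) * (p.1 ∆ p.2).card ≤ 5 * n).card with h0 | h0
          · rw [h0]; norm_num; positivity
          · have h0' : (0 : ℝ) < ((N (K + 1) ×ˢ N K).filter fun p =>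
              4 ^ (K + 1) * (p.1 ∆ p.2).card ≤ 5 * n).card := by exact_mod_cast h0
            rw [Real.log_mul two_ne_zero h0'.ne']
            have h3 := Real.log_le_log h0' hle
            rw [Real.log_mul (hNpos _).ne' (hNpos _).ne'] at h3
            have h5 := hlogN K
            have h6 := hlogN (K + 1)
            push_cast at h6
            nlinarith
        · intro ε
          simp only [Finset.mem_filter, Finset.mem_product]
          refine ⟨⟨hπN _ _ (hτ ε), hπN _ _ (hτ ε)⟩, ?_⟩
          have h3 := hπ (K + 1) _ (hτ ε)
          have h5 := hπ K _ (hτ ε)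
          have h6 := card_symmDiff_le_add (π (K + 1) (τ ε)) (τ ε) (π K (τ ε))
          rw [symmDiff_comm (π (K + 1) (τ ε)) (τ ε)] at h6
          calc _ ≤ 4 ^ (K + 1) * ((τ ε ∆ π (K + 1) (τ ε)).card + (τ ε ∆ π K (τ ε)).card) :=
                Nat.mul_le_mul_left _ h6
            _ = 4 ^ (K + 1) * (τ ε ∆ π (K + 1) (τ ε)).card
                + 4 * (4 ^ K * (τ ε ∆ π K (τ ε)).card) := by ring
            _ ≤ _ := by omega
        · have e : (1 + 2 * a * ((K : ℝ) + 2)) / (2 ^ (K + 1) / √(n : ℝ))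
              + 2 ^ (K + 1) / √(n : ℝ) * (5 * n / 4 ^ (K + 1)) / 2
              = √(n : ℝ) / 2 ^ (K + 1) * (1 + 2 * a * (K + 2) + 5 / 2) := by
            rw [h42]
            nth_rewrite 3 [← hsq2]
            field_simp
          rw [e, hc]
          have : (0 : ℝ) ≤ K := Nat.cast_nonneg K
          calc _ ≤ √(n : ℝ) / 2 ^ (K + 1) * ((2 * a + 4) * (K + 2)) := by
                gcongr; nlinarith
            _ = _ := by ring
      calc 𝔼 ε, |∑ i, sgn (ε i) * ind (π (K + 1) (τ ε)) i|
          ≤ 𝔼 ε, (|∑ i, sgn (ε i) * ind (π K (τ ε)) i|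
            + |∑ i, sgn (ε i) * (ind (π (K + 1) (τ ε)) i - ind (π K (τ ε)) i)|) := by
            refine Finset.expect_le_expect fun ε _ => ?_
            refine le_trans (le_of_eq ?_) (abs_add_le _ _)
            rw [← Finset.sum_add_distrib]
            congr 1
            exact Finset.sum_congr rfl fun i _ => by ring
        _ ≤ chainConst d * √(n : ℝ) * (4 - (K + 3) / 2 ^ K)
            + chainConst d * √(n : ℝ) * ((K + 2) / 2 ^ (K + 1)) := by
            rw [Finset.expect_add_distrib]
            exact add_le_add ih hinc
        _ = _ := by
            push_cast
            rw [pow_succ]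
            field_simp
            ring
  -- At level `n` the radius `n / 4 ^ n` is below 1, so the approximation is exact.
  have hlast := hstep n
  have hπn : ∀ ε, π n (τ ε) = τ ε := by
    intro ε
    have h1 := hπ n _ (hτ ε)
    have h2 : n < 4 ^ n := Nat.lt_pow_self (by norm_num)
    by_contra hne
    have h3 : 0 < (τ ε ∆ π n (τ ε)).card := by
      rw [Finset.card_pos, Finset.nonempty_iff_ne_empty]
      intro h
      exact hne (symmDiff_eq_bot.1 h).symm
    nlinarith
  simp only [hπn] at hlast
  refine hlast.trans ?_
  have h1 : (0 : ℝ) ≤ ((n : ℝ) + 3) / 2 ^ n := by positivity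
  have h2 := mul_pos (chainConst_pos d) hsq
  nlinarith

/-! ### Rademacher averages of classes of bounded pseudo-dimension -/

/-- Termwise comparison with the binomial expansion of `(m + 1) ^ d`. It puts the Sauer–Shelah bound
in polynomial form. -/
theorem sum_choose_le_pow (m d : ℕ) : ∑ k ∈ Finset.Iic d, m.choose k ≤ (m + 1) ^ d := by
  rw [add_pow, Nat.range_succ_eq_Iic]
  refine Finset.sum_le_sum fun k hk => ?_
  rw [one_pow, mul_one]
  calc m.choose k ≤ m ^ k * 1 := by simpa using Nat.choose_le_pow m k
    _ ≤ m ^ k * d.choose k :=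
        Nat.mul_le_mul_left _ (Nat.choose_pos (Finset.mem_Iic.1 hk))

/-- The traces of the superlevel sets `{t < g}`, `g ∈ G`, on the points `p i`. -/
noncomputable def levelFamily {Z : Type*} (G : Set (Z → ℝ)) (t : ℝ) {n : ℕ} (p : Fin n → Z) :
    Finset (Finset (Fin n)) :=
  open Classical in
  Finset.univ.filter fun A => ∃ g ∈ G, A = Finset.univ.filter fun i => t < g (p i)

theorem mem_levelFamily {Z : Type*} {G : Set (Z → ℝ)} {t : ℝ} {n : ℕ} {p : Fin n → Z}
    {A : Finset (Fin n)} :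
    A ∈ levelFamily G t p ↔ ∃ g ∈ G, A = Finset.univ.filter fun i => t < g (p i) := by
  simp [levelFamily]

/-- Index sets shattered by the level family give point sets pseudo-shattered with the constant
threshold `t`, so the VC dimension is at most `d` and Sauer–Shelah applies. -/
theorem card_levelFamily_le {Z : Type*} {G : Set (Z → ℝ)} {d : ℕ} (hd : pseudoDim G ≤ d) (t : ℝ)
    {m : ℕ} (p : Fin m → Z) : (levelFamily G t p).card ≤ (m + 1) ^ d := by
  classical
  have hvc : (levelFamily G t p).vcDim ≤ d := by
    refine Finset.sup_le fun J hJ => ?_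
    rw [Finset.mem_shatterer] at hJ
    -- The sample may repeat points, but a shattered `J` cannot: the trace `{i}` separates `i` from
    -- every other index.
    have hinj : Set.InjOn p (J : Set (Fin m)) := by
      intro i hi j hj hij
      obtain ⟨A, hA, hAJ⟩ := hJ (t := {i}) (by simpa using hi)
      obtain ⟨g, hg, rfl⟩ := mem_levelFamily.1 hA
      have h1 : i ∈ J ∩ Finset.univ.filter fun i => t < g (p i) := by rw [hAJ]; simp
      have h2 : j ∈ J ∩ Finset.univ.filter fun i => t < g (p i) := by
        simp only [Finset.mem_inter, Finset.mem_filter, Finset.mem_univ, true_and] at h1 ⊢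
        exact ⟨hj, hij ▸ h1.2⟩
      rw [hAJ] at h2
      exact (Finset.mem_singleton.1 h2).symm
    have hsh : PseudoShatters G (J.image p) := by
      refine ⟨fun _ => t, fun T hT => ?_⟩
      obtain ⟨A, hA, hAJ⟩ := hJ (t := J.filter fun i => p i ∈ T) (Finset.filter_subset _ _)
      obtain ⟨g, hg, rfl⟩ := mem_levelFamily.1 hA
      refine ⟨g, hg, fun z hz => ?_⟩
      obtain ⟨i, hi, rfl⟩ := Finset.mem_image.1 hz
      have := Finset.ext_iff.1 hAJ i
      simpa [hi] using this
    have h := (le_iSup₂ (f := fun (A : Finset Z) (_ : PseudoShatters G A) => (A.card : ℕ∞))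
      (J.image p) hsh).trans hd
    rw [Finset.card_image_of_injOn hinj] at h
    exact_mod_cast h
  refine (Finset.card_le_card_shatterer _).trans (Finset.card_shatterer_le_sum_vcDim.trans ?_)
  rw [Fintype.card_fin]
  exact (Finset.sum_le_sum_of_subset (Finset.Iic_subset_Iic.2 hvc)).trans (sum_choose_le_pow m d)

theorem hasGrowth_levelFamily {Z : Type*} {G : Set (Z → ℝ)} {d : ℕ} (hd : pseudoDim G ≤ d)
    (t : ℝ) {n : ℕ} (p : Fin n → Z) : HasGrowth (levelFamily G t p) d := by
  intro m s
  refine le_trans (Finset.card_le_card ?_) (card_levelFamily_le hd t (p ∘ s))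
  intro A hA
  obtain ⟨B, hB, rfl⟩ := Finset.mem_image.1 hA
  obtain ⟨g, hg, rfl⟩ := mem_levelFamily.1 hB
  exact mem_levelFamily.2 ⟨g, hg, by ext; simp [trace]⟩

theorem integral_ite_lt {M a : ℝ} (ha : |a| ≤ M) :
    ∫ t in (-M)..M, (if t < a then (1 : ℝ) else 0) = a + M := by
  obtain ⟨h1, h2⟩ := abs_le.1 ha
  have e : (fun t : ℝ => if t < a then (1 : ℝ) else 0) = (Set.Iio a).indicator fun _ => 1 := by
    ext t; simp [Set.indicator]
  rw [intervalIntegral.integral_of_le (by linarith), e,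
    setIntegral_indicator measurableSet_Iio]
  have : Set.Ioc (-M) M ∩ Set.Iio a = Set.Ioo (-M) a := by
    ext t
    simp only [Set.mem_inter_iff, Set.mem_Ioc, Set.mem_Iio, Set.mem_Ioo]
    constructor
    · rintro ⟨⟨h3, _⟩, h4⟩; exact ⟨h3, h4⟩
    · rintro ⟨h3, h4⟩; exact ⟨⟨h3, by linarith⟩, h4⟩
  rw [this]
  simp
  linarith

theorem intervalIntegrable_ite_lt (a b c : ℝ) :
    IntervalIntegrable (fun t : ℝ => if t < a then (1 : ℝ) else 0) volume b c := by
  refine Antitone.intervalIntegrable fun s t hst => ?_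
  split_ifs <;> linarith

/-- By the layer-cake formula, `g` is the integral of `1_{t < g}` over `[-M, M]` minus `M`. For each
`t` the selector `γ` induces a selector in the level family, so the bound for sets integrates in
`t`. -/
theorem expect_abs_sign_le_of_pseudoDim {Z : Type*} {G : Set (Z → ℝ)} {d : ℕ} {M : ℝ}
    (hd : pseudoDim G ≤ d) (hM0 : 0 ≤ M) (hM : ∀ g ∈ G, ∀ z, |g z| ≤ M) {n : ℕ} (p : Fin n → Z)
    (γ : (Fin n → Bool) → Z → ℝ) (hγ : ∀ ε, γ ε ∈ G) :
    𝔼 ε, |∑ i, sgn (ε i) * γ ε (p i)| ≤ 12 * chainConst d * M * √(n : ℝ) := by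
  have hint : ∀ ε : Fin n → Bool, IntervalIntegrable
      (fun t => ∑ i, sgn (ε i) * if t < γ ε (p i) then (1 : ℝ) else 0) volume (-M) M :=
    fun ε => by
      simpa only [Finset.sum_fn] using IntervalIntegrable.sum Finset.univ fun i _ =>
        (intervalIntegrable_ite_lt (γ ε (p i)) (-M) M).const_mul (sgn (ε i))
  have hpt : ∀ ε : Fin n → Bool, |∑ i, sgn (ε i) * γ ε (p i)|
      ≤ (∫ t in (-M)..M, |∑ i, sgn (ε i) * if t < γ ε (p i) then (1 : ℝ) else 0|)
        + M * |∑ i, sgn (ε i) * ind Finset.univ i| := by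
    intro ε
    have e : ∑ i, sgn (ε i) * γ ε (p i)
        = (∫ t in (-M)..M, ∑ i, sgn (ε i) * if t < γ ε (p i) then (1 : ℝ) else 0)
          - M * ∑ i, sgn (ε i) * ind Finset.univ i := by
      rw [intervalIntegral.integral_finsetSum fun i _ =>
        (intervalIntegrable_ite_lt _ _ _).const_mul _, Finset.mul_sum, ← Finset.sum_sub_distrib]
      refine Finset.sum_congr rfl fun i _ => ?_
      rw [intervalIntegral.integral_const_mul, integral_ite_lt (hM _ (hγ ε) _)]
      simp [ind]
      ring
    rw [e]
    refine (abs_sub _ _).trans ?_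
    rw [abs_mul, abs_of_nonneg hM0]
    gcongr
    exact intervalIntegral.abs_integral_le_integral_abs (by linarith)
  -- The constant `M` is handled by the one-set family, which has a single trace.
  have h1 : 𝔼 ε : Fin n → Bool, |∑ i, sgn (ε i) * ind Finset.univ i|
      ≤ 4 * chainConst d * √(n : ℝ) := by
    refine expect_abs_sign_ind_le (𝒜 := {Finset.univ}) (fun m s => ?_) (fun _ => Finset.univ)
      (by simp)
    simpa using Nat.one_le_pow _ _ (by omega)
  have h2 : 𝔼 ε : Fin n → Bool,
      (∫ t in (-M)..M, |∑ i, sgn (ε i) * if t < γ ε (p i) then (1 : ℝ) else 0|)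
      ≤ 2 * M * (4 * chainConst d * √(n : ℝ)) := by
    have hswap : 𝔼 ε : Fin n → Bool,
        (∫ t in (-M)..M, |∑ i, sgn (ε i) * if t < γ ε (p i) then (1 : ℝ) else 0|)
        = ∫ t in (-M)..M,
          𝔼 ε : Fin n → Bool, |∑ i, sgn (ε i) * if t < γ ε (p i) then (1 : ℝ) else 0| := by
      simp only [Fintype.expect_eq_sum_div_card]
      rw [intervalIntegral.integral_div, intervalIntegral.integral_finsetSum]
      exact fun ε _ => (hint ε).abs
    rw [hswap]
    calc _ ≤ ∫ t in (-M)..M, 4 * chainConst d * √(n : ℝ) := by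
          refine intervalIntegral.integral_mono_on (by linarith) ?_ (by simp) fun t _ => ?_
          · simp only [Fintype.expect_eq_sum_div_card]
            refine IntervalIntegrable.div_const ?_ _
            simpa only [Finset.sum_fn] using IntervalIntegrable.sum Finset.univ
              fun ε _ => (hint ε).abs
          · have := expect_abs_sign_ind_le (hasGrowth_levelFamily hd t p)
              (fun ε => Finset.univ.filter fun i => t < γ ε (p i))
              fun ε => mem_levelFamily.2 ⟨_, hγ ε, rfl⟩
            simpa [ind] using this
      _ = _ := by rw [intervalIntegral.integral_const, smul_eq_mul]; ring
  calc _ ≤ 𝔼 ε : Fin n → Bool,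
        ((∫ t in (-M)..M, |∑ i, sgn (ε i) * if t < γ ε (p i) then (1 : ℝ) else 0|)
        + M * |∑ i, sgn (ε i) * ind Finset.univ i|) :=
        Finset.expect_le_expect fun ε _ => hpt ε
    _ ≤ 2 * M * (4 * chainConst d * √(n : ℝ)) + M * (4 * chainConst d * √(n : ℝ)) := by
        rw [Finset.expect_add_distrib, ← Finset.mul_expect]
        gcongr
    _ = _ := by ring

/-! ### Weighted averages -/

/-- The `i`-th marginal of a product of weight vectors is the `i`-th vector, since the other factors
sum to one. -/
theorem sum_piFinset_prod_mul {ι α : Type*} [Fintype ι] [DecidableEq ι] [DecidableEq α]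
    (S : ι → Finset α) (W : ι → α → ℝ) (hW : ∀ i, ∑ y ∈ S i, W i y = 1) (i : ι) (h : α → ℝ) :
    ∑ y ∈ Fintype.piFinset S, (∏ j, W j (y j)) * h (y i) = ∑ y ∈ S i, W i y * h y := by
  have h1 : ∀ y : ι → α, (∏ j, W j (y j)) * h (y i)
      = ∏ j, W j (y j) * if j = i then h (y j) else 1 := by
    intro y
    rw [Finset.prod_mul_distrib]
    congr 1
    simp
  simp only [h1]
  rw [← Finset.prod_univ_sum S fun j y => W j y * if j = i then h y else 1,
    Finset.prod_eq_single i]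
  · simp
  · intro j _ hj; simp [hj, hW]
  · simp

/-- All weighted sums are written as one average over label vectors under the product weights, which
do not depend on `ε`. The triangle inequality moves this average outside the absolute value, and the
sign average is then bounded for each label vector. -/
theorem expect_abs_sign_weighted_le {ι α : Type*} [Fintype ι] [DecidableEq ι] [DecidableEq α]
    (S : ι → Finset α) (W : ι → α → ℝ) (hW0 : ∀ i, ∀ y ∈ S i, 0 ≤ W i y)
    (hW : ∀ i, ∑ y ∈ S i, W i y = 1) (φ : (ι → Bool) → ι → α → ℝ) {B : ℝ}
    (hB : ∀ y : ι → α, (∀ i, y i ∈ S i) → 𝔼 ε, |∑ i, sgn (ε i) * φ ε i (y i)| ≤ B) :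
    𝔼 ε, |∑ i, sgn (ε i) * ∑ y ∈ S i, W i y * φ ε i y| ≤ B := by
  have hP0 : ∀ y ∈ Fintype.piFinset S, 0 ≤ ∏ j, W j (y j) := fun y hy =>
    Finset.prod_nonneg fun j _ => hW0 j _ (Fintype.mem_piFinset.1 hy j)
  calc 𝔼 ε, |∑ i, sgn (ε i) * ∑ y ∈ S i, W i y * φ ε i y|
      ≤ 𝔼 ε, ∑ y ∈ Fintype.piFinset S,
          (∏ j, W j (y j)) * |∑ i, sgn (ε i) * φ ε i (y i)| := by
        refine Finset.expect_le_expect fun ε _ => ?_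
        have e : ∑ i, sgn (ε i) * ∑ y ∈ S i, W i y * φ ε i y
            = ∑ y ∈ Fintype.piFinset S, (∏ j, W j (y j)) * ∑ i, sgn (ε i) * φ ε i (y i) := by
          simp only [← sum_piFinset_prod_mul S W hW, Finset.mul_sum]
          rw [Finset.sum_comm]
          exact Finset.sum_congr rfl fun y _ => Finset.sum_congr rfl fun i _ => by ring
        rw [e]
        refine (Finset.abs_sum_le_sum_abs _ _).trans (Finset.sum_le_sum fun y hy => ?_)
        rw [abs_mul, abs_of_nonneg (hP0 y hy)]
    _ = ∑ y ∈ Fintype.piFinset S,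
          (∏ j, W j (y j)) * 𝔼 ε, |∑ i, sgn (ε i) * φ ε i (y i)| := by
        rw [Finset.expect_sum_comm]
        exact Finset.sum_congr rfl fun y _ => (Finset.mul_expect _ _ _).symm
    _ ≤ ∑ y ∈ Fintype.piFinset S, (∏ j, W j (y j)) * B :=
        Finset.sum_le_sum fun y hy => mul_le_mul_of_nonneg_left
          (hB y (Fintype.mem_piFinset.1 hy)) (hP0 y hy)
    _ = B := by
        rw [← Finset.sum_mul, ← Finset.prod_univ_sum S W]
        simp [hW]

/-! ### Measurability of sums over candidate sets -/

theorem measurable_ncard_inter {B : Set ℝ} (hB : MeasurableSet B) :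
    Measurable fun S : CandidateSet => ((S.labels : Set ℝ) ∩ B).ncard :=
  (comap_measurable (m := ⊤) _).mono
    (le_iSup (fun B : {B : Set ℝ // MeasurableSet B} => MeasurableSpace.comap
      (fun S : CandidateSet => ((S.labels : Set ℝ) ∩ B.1).ncard) ⊤) ⟨B, hB⟩) le_rfl

theorem measurable_card_labels : Measurable fun S : CandidateSet => S.labels.card := by
  simpa using measurable_ncard_inter MeasurableSet.univ

/-- The uniform distribution on the labels of a candidate set (zero for the empty set). -/
noncomputable def uniformLabel : ProbabilityTheory.Kernel CandidateSet ℝ where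
  toFun S := (S.labels.card : ENNReal)⁻¹ • ∑ y ∈ S.labels, Measure.dirac y
  measurable' := by
    refine Measure.measurable_of_measurable_coe _ fun B hB => ?_
    have h : ∀ S : CandidateSet,
        ((S.labels.card : ENNReal)⁻¹ • ∑ y ∈ S.labels, Measure.dirac y) B
          = (S.labels.card : ENNReal)⁻¹ * (((S.labels : Set ℝ) ∩ B).ncard : ENNReal) := by
      classical
      intro S
      have e : (S.labels : Set ℝ) ∩ B = (S.labels.filter fun y => y ∈ B : Finset ℝ) := by
        ext; simp
      rw [e, Set.ncard_coe_finset, Measure.smul_apply, Measure.finsetSum_apply, smul_eq_mul]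
      simp [Measure.dirac_apply' _ hB, Set.indicator_apply]
    simp only [h]
    have h1 : Measurable fun n : ℕ => (n : ENNReal) := measurable_from_nat
    exact (h1.comp measurable_card_labels).inv.mul (h1.comp (measurable_ncard_inter hB))

theorem uniformLabel_apply (S : CandidateSet) :
    uniformLabel S = (S.labels.card : ENNReal)⁻¹ • ∑ y ∈ S.labels, Measure.dirac y := rfl

instance isFiniteKernel_uniformLabel : ProbabilityTheory.IsFiniteKernel uniformLabel := by
  refine ⟨⟨1, ENNReal.one_lt_top, fun S => ?_⟩⟩
  rw [uniformLabel_apply, Measure.smul_apply, Measure.finsetSum_apply, smul_eq_mul]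
  simp [ENNReal.inv_mul_le_one]

theorem integral_uniformLabel (S : CandidateSet) (h : ℝ → ℝ) :
    ∫ y, h y ∂(uniformLabel S) = (S.labels.card : ℝ)⁻¹ * ∑ y ∈ S.labels, h y := by
  rw [uniformLabel_apply, integral_smul_measure, integral_finsetSum_measure]
  · simp [integral_dirac]
  · exact fun y _ => integrable_dirac (by simp)

/-- The sum is the cardinality times an integral against the kernel `uniformLabel`, so measurability
of parametrized integrals applies. -/
theorem measurable_sum_labels {X : Type*} [MeasurableSpace X] {h : X → CandidateSet → ℝ → ℝ}
    (hh : Measurable fun p : X × CandidateSet × ℝ => h p.1 p.2.1 p.2.2) :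
    Measurable fun z : X × CandidateSet => ∑ y ∈ z.2.labels, h z.1 z.2 y := by
  have hf : StronglyMeasurable fun q : (X × CandidateSet) × ℝ => h q.1.1 q.1.2 q.2 :=
    (hh.comp (f := fun q : (X × CandidateSet) × ℝ => (q.1.1, q.1.2, q.2))
      (by fun_prop)).stronglyMeasurable
  have h1 := (hf.integral_kernel_prod_right'
    (κ := uniformLabel.comap Prod.snd measurable_snd)).measurable
  simp only [ProbabilityTheory.Kernel.comap_apply, integral_uniformLabel] at h1
  have h2 : Measurable fun z : X × CandidateSet => (z.2.labels.card : ℝ) :=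
    (measurable_from_nat (f := fun n : ℕ => (n : ℝ))).comp
      (measurable_card_labels.comp measurable_snd)
  convert h2.mul h1 using 1
  funext z
  rcases Finset.eq_empty_or_nonempty z.2.labels with h0 | h0
  · simp [h0]
  · have : (z.2.labels.card : ℝ) ≠ 0 := by exact_mod_cast h0.card_pos.ne'
    simp only [Pi.mul_apply]
    field_simp

theorem measurable_wetLoss {X : Type*} [MeasurableSpace X] {ℓ : ℝ → ℝ → ℝ}
    {w : X → CandidateSet → ℝ → ℝ} {f : X → ℝ}
    (hℓ : Measurable fun p : ℝ × ℝ => ℓ p.1 p.2)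
    (hw : Measurable fun p : X × CandidateSet × ℝ => w p.1 p.2.1 p.2.2) (hf : Measurable f) :
    Measurable (wetLoss ℓ w f) := by
  refine measurable_sum_labels (h := fun x S y => w x S y * ℓ (f x) y) (hw.mul ?_)
  exact hℓ.comp (f := fun p : X × CandidateSet × ℝ => (f p.1, p.2.2)) (by fun_prop)

/-! ### Symmetrization -/

theorem measurePreserving_comp_equiv {ι ι' Z : Type*} [Fintype ι] [Fintype ι']
    [MeasurableSpace Z] (P : Measure Z) [SigmaFinite P] (σ : ι' ≃ ι) :
    MeasurePreserving (fun s : ι → Z => s ∘ σ) (Measure.pi fun _ => P)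
      (Measure.pi fun _ => P) :=
  measurePreserving_arrowCongr' (fun _ => P) (fun _ => P) σ.symm (MeasurableEquiv.refl Z)
    fun _ => MeasurePreserving.id P

theorem IsMeasurableClass.aemeasurable_iSup {ι Z : Type*} [Fintype ι] [MeasurableSpace Z]
    {P : Measure Z} [SigmaFinite P] {G : Set (Z → ℝ)} (hG : IsMeasurableClass P G) (e : ι → ℝ) :
    AEMeasurable (fun s : ι → Z => ⨆ g : G, |∑ i, e i * (g : Z → ℝ) (s i)|)
      (Measure.pi fun _ => P) := by
  have h := (hG _ (e ∘ (Fintype.equivFin ι).symm)).comp_quasiMeasurePreserving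
    (measurePreserving_comp_equiv P (Fintype.equivFin ι).symm).quasiMeasurePreserving
  refine h.congr (Filter.Eventually.of_forall fun s => ?_)
  simp only [Function.comp_apply]
  congr 1
  funext g
  rw [(Fintype.equivFin ι).symm.sum_comp fun i => e i * (g : Z → ℝ) (s i)]

/-- The transpositions that exchange the two copies of `i` wherever `ε i` is false. -/
def swapEquiv {ι : Type*} (ε : ι → Bool) : ι ⊕ ι ≃ ι ⊕ ι where
  toFun := Sum.elim (fun i => if ε i then .inl i else .inr i)
    fun i => if ε i then .inr i else .inl i
  invFun := Sum.elim (fun i => if ε i then .inl i else .inr i)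
    fun i => if ε i then .inr i else .inl i
  left_inv := by rintro (i | i) <;> by_cases h : ε i <;> simp [h]
  right_inv := by rintro (i | i) <;> by_cases h : ε i <;> simp [h]

/-- The supremum over `G` of the absolute difference of the sums over the two half samples, with
the signs `ε` in front of the differences. -/
noncomputable def signedSup {Z : Type*} (G : Set (Z → ℝ)) {ι : Type*} [Fintype ι] (ε : ι → Bool)
    (s : ι ⊕ ι → Z) : ℝ :=
  ⨆ g : G, |∑ i, sgn (ε i) * ((g : Z → ℝ) (s (.inl i)) - (g : Z → ℝ) (s (.inr i)))|

theorem signedSup_nonneg {Z : Type*} (G : Set (Z → ℝ)) {ι : Type*} [Fintype ι] (ε : ι → Bool)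
    (s : ι ⊕ ι → Z) : 0 ≤ signedSup G ε s :=
  Real.iSup_nonneg fun _ => abs_nonneg _

/-- Flipping a sign amounts to exchanging the two copies of that coordinate. -/
theorem signedSup_eq_comp {Z : Type*} (G : Set (Z → ℝ)) {ι : Type*} [Fintype ι] (ε : ι → Bool)
    (s : ι ⊕ ι → Z) : signedSup G ε s = signedSup G (fun _ => true) (s ∘ swapEquiv ε) := by
  unfold signedSup
  congr 1
  funext g
  congr 1
  refine Finset.sum_congr rfl fun i _ => ?_
  by_cases h : ε i <;> simp [swapEquiv, sgn, h]

theorem abs_sign_sum_sub_le {ι : Type*} [Fintype ι] (ε : ι → Bool) (a b : ι → ℝ) {M : ℝ}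
    (ha : ∀ i, |a i| ≤ M) (hb : ∀ i, |b i| ≤ M) :
    |∑ i, sgn (ε i) * (a i - b i)| ≤ Fintype.card ι * (2 * M) := by
  refine (Finset.abs_sum_le_sum_abs _ _).trans ?_
  rw [← nsmul_eq_mul, ← Finset.card_univ]
  refine Finset.sum_le_card_nsmul _ _ _ fun i _ => ?_
  have h1 : |sgn (ε i)| = 1 := by cases ε i <;> simp [sgn]
  rw [abs_mul, h1, one_mul]
  have := abs_sub (a i) (b i)
  linarith [ha i, hb i]

section Symmetrization

variable {Z : Type*} {G : Set (Z → ℝ)} {ι : Type*} [Fintype ι]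

theorem bddAbove_signed {M : ℝ} {ε : ι → Bool} {s : ι ⊕ ι → Z}
    (hM : ∀ g ∈ G, ∀ j, |g (s j)| ≤ M) :
    BddAbove (Set.range fun g : G =>
      |∑ i, sgn (ε i) * ((g : Z → ℝ) (s (.inl i)) - (g : Z → ℝ) (s (.inr i)))|) := by
  refine ⟨Fintype.card ι * (2 * M), ?_⟩
  rintro _ ⟨g, rfl⟩
  exact abs_sign_sum_sub_le _ _ _ (fun i => hM g g.2 _) fun i => hM g g.2 _

theorem signedSup_le {M : ℝ} (hne : G.Nonempty) {ε : ι → Bool} {s : ι ⊕ ι → Z}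
    (hM : ∀ g ∈ G, ∀ j, |g (s j)| ≤ M) : signedSup G ε s ≤ Fintype.card ι * (2 * M) := by
  have : Nonempty G := hne.to_subtype
  exact ciSup_le fun g => abs_sign_sum_sub_le _ _ _ (fun i => hM g g.2 _) fun i => hM g g.2 _

/-- For each sign vector choose a member of `G` within `η` of the supremum, which need not be
attained, and treat the two half samples separately. -/
theorem expect_signedSup_le [DecidableEq ι] {b : ℝ} (hne : G.Nonempty) {s : ι ⊕ ι → Z}
    (hl : ∀ γ : (ι → Bool) → Z → ℝ, (∀ ε, γ ε ∈ G) →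
      𝔼 ε, |∑ i, sgn (ε i) * γ ε (s (.inl i))| ≤ b)
    (hr : ∀ γ : (ι → Bool) → Z → ℝ, (∀ ε, γ ε ∈ G) →
      𝔼 ε, |∑ i, sgn (ε i) * γ ε (s (.inr i))| ≤ b) :
    𝔼 ε, signedSup G ε s ≤ 2 * b := by
  have : Nonempty G := hne.to_subtype
  refine le_of_forall_pos_le_add fun η hη => ?_
  have hex : ∀ ε : ι → Bool, ∃ g ∈ G,
      signedSup G ε s ≤ |∑ i, sgn (ε i) * (g (s (.inl i)) - g (s (.inr i)))| + η := by
    intro ε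
    obtain ⟨g, hg⟩ := exists_lt_of_lt_ciSup (show signedSup G ε s - η < signedSup G ε s by linarith)
    exact ⟨g, g.2, by linarith⟩
  choose γ hγ hγη using hex
  calc 𝔼 ε, signedSup G ε s
      ≤ 𝔼 ε, (|∑ i, sgn (ε i) * γ ε (s (.inl i))| + |∑ i, sgn (ε i) * γ ε (s (.inr i))|
          + η) := by
        refine Finset.expect_le_expect fun ε _ => (hγη ε).trans ?_
        simp only [mul_sub, Finset.sum_sub_distrib]
        gcongr
        exact abs_sub _ _
    _ ≤ b + b + η := by
        rw [Finset.expect_add_distrib, Finset.expect_add_distrib, Fintype.expect_const]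
        gcongr
        exacts [hl γ hγ, hr γ hγ]
    _ = _ := by ring

variable [MeasurableSpace Z] {P : Measure Z} [IsProbabilityMeasure P]

theorem ae_pi_forall {p : Z → Prop} (hp : ∀ᵐ z ∂P, p z) :
    ∀ᵐ s ∂(Measure.pi fun _ : ι => P), ∀ i, p (s i) :=
  ae_all_iff.2 fun i => (Measure.quasiMeasurePreserving_eval (fun _ => P) i).ae hp

theorem IsMeasurableClass.integrable_signedSup (hG : IsMeasurableClass P G) (hne : G.Nonempty)
    {M : ℝ} (hM : ∀ᵐ z ∂P, ∀ g ∈ G, |g z| ≤ M) (ε : ι → Bool) :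
    Integrable (signedSup G ε) (Measure.pi fun _ : ι ⊕ ι => P) := by
  have hmeas : AEMeasurable (signedSup G ε) (Measure.pi fun _ : ι ⊕ ι => P) := by
    refine (hG.aemeasurable_iSup
      (Sum.elim (fun i => sgn (ε i)) fun i => -sgn (ε i))).congr
      (Filter.Eventually.of_forall fun s => ?_)
    simp only [signedSup, Fintype.sum_sum_type, Sum.elim_inl, Sum.elim_inr,
      ← Finset.sum_add_distrib]
    congr 1
    funext g
    congr 1
    exact Finset.sum_congr rfl fun i _ => by ring
  refine Integrable.of_bound hmeas.aestronglyMeasurable (Fintype.card ι * (2 * M)) ?_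
  filter_upwards [ae_pi_forall (ι := ι ⊕ ι) hM] with s hs
  rw [Real.norm_of_nonneg (signedSup_nonneg _ _ _)]
  exact signedSup_le hne fun g hg j => hs j g hg

/-- Exchanging coordinates preserves the product measure, so every sign pattern yields the same
integral. It therefore equals the integral of the sign average, which is bounded sample by sample.
-/
theorem integral_signedSup_le [DecidableEq ι] (hG : IsMeasurableClass P G) (hne : G.Nonempty)
    {M b : ℝ} {good : Z → Prop} (hgood : ∀ᵐ z ∂P, good z)
    (hM : ∀ z, good z → ∀ g ∈ G, |g z| ≤ M)
    (hb : ∀ z : ι → Z, (∀ i, good (z i)) → ∀ γ : (ι → Bool) → Z → ℝ, (∀ ε, γ ε ∈ G) →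
      𝔼 ε, |∑ i, sgn (ε i) * γ ε (z i)| ≤ b) :
    ∫ s, signedSup G (fun _ : ι => true) s ∂(Measure.pi fun _ : ι ⊕ ι => P) ≤ 2 * b := by
  have hM' : ∀ᵐ z ∂P, ∀ g ∈ G, |g z| ≤ M := hgood.mono hM
  have hint := fun ε : ι → Bool => hG.integrable_signedSup hne hM' ε
  have hinv : ∀ ε : ι → Bool, ∫ s, signedSup G ε s ∂(Measure.pi fun _ : ι ⊕ ι => P)
      = ∫ s, signedSup G (fun _ : ι => true) s ∂(Measure.pi fun _ : ι ⊕ ι => P) := by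
    intro ε
    have hmp := measurePreserving_comp_equiv P (swapEquiv ε)
    have h := integral_map (f := signedSup G fun _ : ι => true) hmp.measurable.aemeasurable
      (by rw [hmp.map_eq]; exact (hint _).aestronglyMeasurable)
    rw [hmp.map_eq] at h
    rw [h]
    simp only [signedSup_eq_comp G ε]
  calc ∫ s, signedSup G (fun _ : ι => true) s ∂(Measure.pi fun _ : ι ⊕ ι => P)
      = 𝔼 ε : ι → Bool, ∫ s, signedSup G ε s ∂(Measure.pi fun _ : ι ⊕ ι => P) := by
        simp only [hinv, Fintype.expect_const]
    _ = ∫ s, 𝔼 ε : ι → Bool, signedSup G ε s ∂(Measure.pi fun _ : ι ⊕ ι => P) := by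
        simp only [Fintype.expect_eq_sum_div_card]
        rw [integral_div, integral_finsetSum _ fun ε _ => hint ε]
    _ ≤ ∫ _, 2 * b ∂(Measure.pi fun _ : ι ⊕ ι => P) := by
        refine integral_mono_ae ?_ (integrable_const _) ?_
        · simp only [Fintype.expect_eq_sum_div_card]
          exact (integrable_finsetSum _ fun ε _ => hint ε).div_const _
        · filter_upwards [ae_pi_forall (ι := ι ⊕ ι) hgood] with s hs
          exact expect_signedSup_le hne (hb (s ∘ .inl) fun i => hs _)
            (hb (s ∘ .inr) fun i => hs _)
    _ = 2 * b := by simp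

/-- Symmetrization: the uniform deviation of sums from their means has an integrable majorant
whose integral is at most twice the Rademacher complexity. -/
theorem exists_deviation_majorant [DecidableEq ι] (hG : IsMeasurableClass P G)
    (hne : G.Nonempty) (hGm : ∀ g ∈ G, Measurable g)
    {M b : ℝ} {good : Z → Prop} (hgood : ∀ᵐ z ∂P, good z)
    (hM : ∀ z, good z → ∀ g ∈ G, |g z| ≤ M)
    (hb : ∀ z : ι → Z, (∀ i, good (z i)) → ∀ γ : (ι → Bool) → Z → ℝ, (∀ ε, γ ε ∈ G) →
      𝔼 ε, |∑ i, sgn (ε i) * γ ε (z i)| ≤ b) :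
    ∃ K : (ι → Z) → ℝ, Integrable K (Measure.pi fun _ => P) ∧ (∀ s, 0 ≤ K s) ∧
      ∫ s, K s ∂(Measure.pi fun _ => P) ≤ 2 * b ∧
      ∀ᵐ s ∂(Measure.pi fun _ => P), ∀ g ∈ G,
        |∑ i, g (s i) - Fintype.card ι * ∫ z, g z ∂P| ≤ K s := by
  have hM' : ∀ᵐ z ∂P, ∀ g ∈ G, |g z| ≤ M := hgood.mono hM
  set H : (ι → Z) × (ι → Z) → ℝ := fun q => signedSup G (fun _ : ι => true) (Sum.elim q.1 q.2)
    with hH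
  have hmp := measurePreserving_sumPiEquivProdPi_symm (X := fun _ : ι ⊕ ι => Z) fun _ => P
  have hcomp : ∀ q, H q = signedSup G (fun _ : ι => true)
      ((MeasurableEquiv.sumPiEquivProdPi fun _ : ι ⊕ ι => Z).symm q) := by
    intro q
    simp only [hH]
    congr 1
  have hHint : Integrable H ((Measure.pi fun _ : ι => P).prod (Measure.pi fun _ : ι => P)) := by
    rw [funext hcomp]
    exact hmp.integrable_comp_of_integrable
      (hG.integrable_signedSup hne hM' fun _ : ι => true)
  have hHval : ∫ q, H q ∂((Measure.pi fun _ : ι => P).prod (Measure.pi fun _ : ι => P)) ≤ 2 * b := by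
    rw [funext hcomp, hmp.integral_comp' (signedSup G fun _ : ι => true)]
    exact integral_signedSup_le hG hne hgood hM hb
  -- The majorant averages over an independent ghost sample `t`. Being a partial integral of `H`, it
  -- is integrable even though the supremum of the deviations themselves is not known to be
  -- measurable.
  refine ⟨fun s => ∫ t, H (s, t) ∂(Measure.pi fun _ => P), hHint.integral_prod_left,
    fun s => integral_nonneg fun t => signedSup_nonneg _ _ _, ?_, ?_⟩
  · rwa [← integral_prod H hHint]
  · filter_upwards [hHint.prod_right_ae, ae_pi_forall (ι := ι) hM'] with s hs hsM g hg
    have hgint : Integrable g P :=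
      Integrable.of_bound (hGm g hg).aestronglyMeasurable M (hM'.mono fun z hz => hz g hg)
    have heval : ∀ i : ι, Integrable (fun t : ι → Z => g (t i)) (Measure.pi fun _ => P) := fun i =>
      (measurePreserving_eval (fun _ : ι => P) i).integrable_comp_of_integrable hgint
    have hevalint : ∀ i : ι, ∫ t : ι → Z, g (t i) ∂(Measure.pi fun _ => P) = ∫ z, g z ∂P := by
      intro i
      have hmp := measurePreserving_eval (fun _ : ι => P) i
      have h := integral_map (f := g) hmp.measurable.aemeasurable
        (by rw [hmp.map_eq]; exact hgint.aestronglyMeasurable)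
      rw [hmp.map_eq] at h
      exact h.symm
    have e : ∑ i, g (s i) - Fintype.card ι * ∫ z, g z ∂P
        = ∫ t : ι → Z, (∑ i, g (s i) - ∑ i, g (t i)) ∂(Measure.pi fun _ => P) := by
      rw [integral_sub (integrable_const _) (integrable_finsetSum _ fun i _ => heval i),
        integral_finsetSum _ fun i _ => heval i]
      simp [hevalint]
    rw [e]
    refine (abs_integral_le_integral_abs).trans (integral_mono_ae ?_ hs ?_)
    · exact ((integrable_const _).sub (integrable_finsetSum _ fun i _ => heval i)).abs
    · filter_upwards [ae_pi_forall (ι := ι) hM'] with t htM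
      refine le_trans (le_of_eq ?_) (le_ciSup (bddAbove_signed (M := M) (ε := fun _ : ι => true)
        (s := Sum.elim s t) ?_) ⟨g, hg⟩)
      · simp [sgn]
      · rintro g hg (j | j)
        exacts [hsM j g hg, htM j g hg]

end Symmetrization

/-! ### The weighted loss class -/

section WeightedLoss

variable {X : Type*} {ℓ : ℝ → ℝ → ℝ} {w : X → CandidateSet → ℝ → ℝ} {𝒴 : Set ℝ}
  {F : Set (X → ℝ)}

/-- The labels of the training example `z` lie in `𝒴` and its weights form a probability
vector. -/
def IsGoodExample (w : X → CandidateSet → ℝ → ℝ) (𝒴 : Set ℝ) (z : X × CandidateSet) : Prop :=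
  (∀ y ∈ z.2.labels, y ∈ 𝒴) ∧
    (∀ y ∈ z.2.labels, 0 ≤ w z.1 z.2 y) ∧ ∑ y ∈ z.2.labels, w z.1 z.2 y = 1

theorem abs_wetLoss_le {M : ℝ} (hM : ∀ f ∈ F, ∀ x, ∀ y ∈ 𝒴, |ℓ (f x) y| ≤ M) {f : X → ℝ}
    (hf : f ∈ F) {z : X × CandidateSet} (hz : IsGoodExample w 𝒴 z) : |wetLoss ℓ w f z| ≤ M := by
  obtain ⟨hy, hw0, hw1⟩ := hz
  refine (Finset.abs_sum_le_sum_abs _ _).trans ?_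
  rw [← one_mul M, ← hw1, Finset.sum_mul]
  refine Finset.sum_le_sum fun y hyS => ?_
  rw [abs_mul, abs_of_nonneg (hw0 y hyS)]
  exact mul_le_mul_of_nonneg_left (hM f hf _ y (hy y hyS)) (hw0 y hyS)

/-- Once a label is chosen from each candidate set, the points `(xᵢ, yᵢ)` lie in `X × 𝒴`, where the
pseudo-dimension bound holds. -/
theorem expect_abs_sign_wetLoss_le {d : ℕ} {M : ℝ} (hd : pseudoDim (lossClass ℓ 𝒴 F) ≤ d)
    (hM0 : 0 ≤ M) (hM : ∀ f ∈ F, ∀ x, ∀ y ∈ 𝒴, |ℓ (f x) y| ≤ M) {n : ℕ}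
    {z : Fin n → X × CandidateSet} (hz : ∀ i, IsGoodExample w 𝒴 (z i))
    (γ : (Fin n → Bool) → X × CandidateSet → ℝ) (hγ : ∀ ε, γ ε ∈ wetLoss ℓ w '' F) :
    𝔼 ε, |∑ i, sgn (ε i) * γ ε (z i)| ≤ 12 * chainConst d * M * √(n : ℝ) := by
  choose f hfF hfγ using hγ
  simp only [← hfγ, wetLoss]
  refine expect_abs_sign_weighted_le (fun i => (z i).2.labels) (fun i => w (z i).1 (z i).2)
    (fun i => (hz i).2.1) (fun i => (hz i).2.2) (fun ε i y => ℓ (f ε (z i).1) y) fun y hy => ?_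
  refine expect_abs_sign_le_of_pseudoDim hd hM0 ?_
    (fun i => ((z i).1, (⟨y i, (hz i).1 _ (hy i)⟩ : 𝒴)))
    (fun ε p => ℓ (f ε p.1) p.2) fun ε => ⟨f ε, hfF ε, rfl⟩
  rintro _ ⟨g, hg, rfl⟩ p
  exact hM g hg _ _ p.2.2

variable [MeasurableSpace X]

theorem measurable_train : Measurable fun z : X × ℝ × CandidateSet => (z.1, z.2.2) := by
  fun_prop

theorem ae_isGoodExample {ρ : Measure (X × ℝ × CandidateSet)} (h𝒴 : MeasurableSet 𝒴)
    (hS : ∀ᵐ z ∂ρ, z.2.1 ∈ z.2.2.labels ∧ ∀ y ∈ z.2.2.labels, y ∈ 𝒴)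
    (hw : ∀ᵐ z ∂(trainLaw ρ),
      (∀ y ∈ z.2.labels, 0 ≤ w z.1 z.2 y) ∧ ∑ y ∈ z.2.labels, w z.1 z.2 y = 1) :
    ∀ᵐ z ∂(trainLaw ρ), IsGoodExample w 𝒴 z := by
  -- Passing to the image law requires a measurable event: the number of labels outside `𝒴` is zero.
  have hset : MeasurableSet {z : X × CandidateSet | ∀ y ∈ z.2.labels, y ∈ 𝒴} := by
    have e : {z : X × CandidateSet | ∀ y ∈ z.2.labels, y ∈ 𝒴}
        = (fun z : X × CandidateSet => ((z.2.labels : Set ℝ) ∩ 𝒴ᶜ).ncard) ⁻¹' {0} := by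
      ext z
      simp only [Set.mem_ofPred_eq, Set.mem_preimage, Set.mem_singleton_iff]
      rw [Set.ncard_eq_zero (z.2.labels.finite_toSet.inter_of_left _),
        Set.eq_empty_iff_forall_notMem]
      simp
    rw [e]
    exact ((measurable_ncard_inter h𝒴.compl).comp measurable_snd) (measurableSet_singleton 0)
  have h1 : ∀ᵐ z ∂(trainLaw ρ), ∀ y ∈ z.2.labels, y ∈ 𝒴 :=
    (ae_map_iff measurable_train.aemeasurable hset).2 (hS.mono fun z hz => hz.2)
  filter_upwards [h1, hw] with z hz1 hz2 using ⟨hz1, hz2⟩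

/-- With optimal weights, the weighted risk is the risk with respect to the true label. -/
theorem wetRisk_eq_risk {ρ : Measure (X × ℝ × CandidateSet)} {f : X → ℝ}
    (hf : Measurable (wetLoss ℓ w f))
    (hS : ∀ᵐ z ∂ρ, z.2.1 ∈ z.2.2.labels ∧ ∀ y ∈ z.2.2.labels, y ∈ 𝒴)
    (hw : ∀ᵐ z ∂ρ, w z.1 z.2.2 z.2.1 = 1 ∧
      ∀ y ∈ z.2.2.labels, y ≠ z.2.1 → w z.1 z.2.2 y = 0) :
    wetRisk ℓ w (trainLaw ρ) f = risk ℓ ρ f := by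
  rw [wetRisk, risk, trainLaw,
    integral_map measurable_train.aemeasurable hf.aestronglyMeasurable]
  refine integral_congr_ae ?_
  filter_upwards [hS, hw] with z hz hwz
  rw [wetLoss, Finset.sum_eq_single z.2.1]
  · simp [hwz.1]
  · intro y hy hne; simp [hwz.2 y hy hne]
  · exact fun h => absurd hz.1 h

end WeightedLoss

/-- Comparison of the risks of an empirical minimizer and of a competitor, given a bound on the
deviations of the sums of losses from their means. -/
theorem wetRisk_sub_le_of_deviation {X : Type*} [MeasurableSpace X] {ℓ : ℝ → ℝ → ℝ}
    {w : X → CandidateSet → ℝ → ℝ} {F : Set (X → ℝ)} {P : Measure (X × CandidateSet)} {n : ℕ}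
    (hn : 0 < n) {s : Fin n → X × CandidateSet} {k : ℝ}
    (hk : ∀ g ∈ wetLoss ℓ w '' F, |∑ i, g (s i) - n * ∫ z, g z ∂P| ≤ k) {f₀ f : X → ℝ}
    (hf₀ : f₀ ∈ F) (hf : IsMinimizer F (empWetRisk ℓ w s) f) :
    n * (wetRisk ℓ w P f - wetRisk ℓ w P f₀) ≤ 2 * k := by
  have hn' : (0 : ℝ) < 1 / n := by positivity
  have h1 := le_of_mul_le_mul_left (hf.2 f₀ hf₀) hn'
  have h2 := abs_le.1 (hk _ ⟨f, hf.1, rfl⟩)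
  have h3 := abs_le.1 (hk _ ⟨f₀, hf₀, rfl⟩)
  simp only [wetRisk]
  linarith [h2.1, h3.2]

/-- Markov's inequality in the form used for outer probabilities. -/
theorem measure_le_ofReal_of_integral_le {Ω : Type*} [MeasurableSpace Ω] {μ : Measure Ω}
    [IsFiniteMeasure μ] {K : Ω → ℝ} (hK : Integrable K μ) (hK0 : ∀ s, 0 ≤ K s) {t δ : ℝ}
    (ht : 0 < t) (hle : ∫ s, K s ∂μ ≤ t * δ) {E : Set Ω} (hE : ∀ᵐ s ∂μ, s ∈ E → t ≤ K s) :
    μ E ≤ ENNReal.ofReal δ := by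
  have h1 : μ E ≤ μ {s | t ≤ K s} := measure_mono_ae hE
  refine h1.trans ?_
  have h2 := mul_meas_ge_le_integral_of_nonneg (Filter.Eventually.of_forall hK0) hK t
  rw [← ofReal_measureReal]
  exact ENNReal.ofReal_le_ofReal (le_of_mul_le_mul_left (h2.trans hle) ht)

end PLR

/-! ### The estimation error bound -/

theorem theorem4 (d : ℕ) (M δ : ℝ) (hδ : 0 < δ) :
    ∃ C : ℝ, ∀ (X : Type*) [MeasurableSpace X] (𝒴 : Set ℝ)
      -- the law of `(x, y, S)`: instance, true label, candidate label set
      (ρ : Measure (X × ℝ × PLR.CandidateSet)) [IsProbabilityMeasure ρ]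
      -- loss, weighting function, hypothesis space
      (ℓ : ℝ → ℝ → ℝ) (w : X → PLR.CandidateSet → ℝ → ℝ) (F : Set (X → ℝ)),
      MeasurableSet 𝒴 →
      Measurable (fun p : ℝ × ℝ => ℓ p.1 p.2) →
      Measurable (fun p : X × PLR.CandidateSet × ℝ => w p.1 p.2.1 p.2.2) →
      (∀ f ∈ F, Measurable f) →
      PLR.IsMeasurableClass (PLR.trainLaw ρ) (PLR.wetLoss ℓ w '' F) →
      -- candidate labels lie in `𝒴`, and the true label is one of them
      (∀ᵐ z ∂ρ, z.2.1 ∈ z.2.2.labels ∧ ∀ y ∈ z.2.2.labels, y ∈ 𝒴) →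
      -- the weights of the candidate labels are nonnegative and add up to one
      (∀ᵐ z ∂(PLR.trainLaw ρ),
        (∀ y ∈ z.2.labels, 0 ≤ w z.1 z.2 y) ∧ ∑ y ∈ z.2.labels, w z.1 z.2 y = 1) →
      -- pseudo-dimension and boundedness
      PLR.pseudoDim (PLR.lossClass ℓ 𝒴 F) ≤ d →
      (∀ f ∈ F, ∀ x, ∀ y ∈ 𝒴, |ℓ (f x) y| ≤ M) →
      ∀ fstar : X → ℝ, PLR.IsMinimizer F (PLR.risk ℓ ρ) fstar →
      -- the estimation error is at most `C / √n` with probability at least `1 - δ`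
      (∀ n : ℕ, 0 < n →
        Measure.pi (fun _ : Fin n => PLR.trainLaw ρ)
          {s | ∃ fhat, PLR.IsMinimizer F (PLR.empWetRisk ℓ w s) fhat ∧
            C / √(n : ℝ) < PLR.wetRisk ℓ w (PLR.trainLaw ρ) fhat
              - PLR.wetRisk ℓ w (PLR.trainLaw ρ) fstar} ≤ ENNReal.ofReal δ) ∧
      -- if the weights single out the true label, this holds for its absolute value
      ((∀ᵐ z ∂ρ, w z.1 z.2.2 z.2.1 = 1 ∧
          ∀ y ∈ z.2.2.labels, y ≠ z.2.1 → w z.1 z.2.2 y = 0) →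
        ∀ n : ℕ, 0 < n →
          Measure.pi (fun _ : Fin n => PLR.trainLaw ρ)
            {s | ∃ fhat, PLR.IsMinimizer F (PLR.empWetRisk ℓ w s) fhat ∧
              C / √(n : ℝ) < |PLR.wetRisk ℓ w (PLR.trainLaw ρ) fhat
                - PLR.wetRisk ℓ w (PLR.trainLaw ρ) fstar|} ≤ ENNReal.ofReal δ) := by
  -- The factor 48 is 12 from the Rademacher bound, doubled by symmetrization and again by comparing
  -- two risks. Using `|M| + 1` keeps the constant positive for every real `M`.
  refine ⟨48 * PLR.chainConst d * (|M| + 1) / δ, ?_⟩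
  intro X _ 𝒴 ρ _ ℓ w F h𝒴 hℓ hw hF hclass hS hwt hd hM fstar hstar
  set C : ℝ := 48 * PLR.chainConst d * (|M| + 1) / δ with hC
  have hc := PLR.chainConst_pos d
  have hCpos : 0 < C := by positivity
  have : IsProbabilityMeasure (PLR.trainLaw ρ) :=
    Measure.isProbabilityMeasure_map PLR.measurable_train.aemeasurable
  have hM' : ∀ f ∈ F, ∀ x, ∀ y ∈ 𝒴, |ℓ (f x) y| ≤ |M| + 1 := fun f hf x y hy =>
    (hM f hf x y hy).trans (by linarith [le_abs_self M])
  have hgood := PLR.ae_isGoodExample h𝒴 hS hwt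
  have hmeas : ∀ f ∈ F, Measurable (PLR.wetLoss ℓ w f) := fun f hf =>
    PLR.measurable_wetLoss hℓ hw (hF f hf)
  have hbound : ∀ n : ℕ, 0 < n →
      Measure.pi (fun _ : Fin n => PLR.trainLaw ρ)
        {s | ∃ fhat, PLR.IsMinimizer F (PLR.empWetRisk ℓ w s) fhat ∧
          C / √(n : ℝ) < PLR.wetRisk ℓ w (PLR.trainLaw ρ) fhat
            - PLR.wetRisk ℓ w (PLR.trainLaw ρ) fstar} ≤ ENNReal.ofReal δ := by
    intro n hn
    have hsq : 0 < √(n : ℝ) := Real.sqrt_pos.2 (by exact_mod_cast hn)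
    have hsq2 : √(n : ℝ) * √(n : ℝ) = n := Real.mul_self_sqrt (Nat.cast_nonneg n)
    obtain ⟨K, hKint, hK0, hKle, hKdev⟩ := PLR.exists_deviation_majorant (ι := Fin n)
      (P := PLR.trainLaw ρ) (G := PLR.wetLoss ℓ w '' F) (M := |M| + 1)
      (b := 12 * PLR.chainConst d * (|M| + 1) * √(n : ℝ)) hclass ⟨_, fstar, hstar.1, rfl⟩
      (by rintro _ ⟨f, hf, rfl⟩; exact hmeas f hf) hgood
      (by rintro z hz _ ⟨f, hf, rfl⟩; exact PLR.abs_wetLoss_le hM' hf hz)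
      fun z hz γ hγ => PLR.expect_abs_sign_wetLoss_le hd (by positivity) hM' hz γ hγ
    refine PLR.measure_le_ofReal_of_integral_le hKint hK0 (t := C * √(n : ℝ) / 2) (by positivity)
      (hKle.trans (le_of_eq ?_)) ?_
    · rw [hC]; field_simp; ring
    · filter_upwards [hKdev] with s hs
      rintro ⟨fhat, hfhat, hlt⟩
      have h1 := PLR.wetRisk_sub_le_of_deviation hn (by simpa using hs) hstar.1 hfhat
      rw [div_lt_iff₀ hsq] at hlt
      have h2 := mul_lt_mul_of_pos_right hlt hsq
      rw [mul_assoc _ √(n : ℝ) √(n : ℝ), hsq2] at h2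
      linarith
  refine ⟨hbound, fun hopt n hn => le_trans (measure_mono ?_) (hbound n hn)⟩
  rintro s ⟨fhat, hfhat, hlt⟩
  refine ⟨fhat, hfhat, ?_⟩
  -- With optimal weights the weighted risk is the true risk, which `fstar` minimizes, so the
  -- difference is nonnegative and the first bound suffices.
  rwa [abs_of_nonneg] at hlt
  rw [PLR.wetRisk_eq_risk (hmeas _ hfhat.1) hS hopt, PLR.wetRisk_eq_risk (hmeas _ hstar.1) hS hopt]
  exact sub_nonneg.2 (hstar.2 _ hfhat.1)
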